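/- **Conventions.** Let $\mathbf{Gr}$ be the category of undirected reflexive graphs without parallel edges. An object is a vertex set with a simple graph on it, every vertex carrying an implicit loop. A morphism is a map of vertices sending the two endpoints of each edge to adjacent vertices or to one and the same vertex. Let $\Omega=\binom{-}{2}\colon \mathbf{FinSet}\to\mathbf{Gr}$ send a finite set to the complete graph on it, and let $K_n$ be the complete graph on $n\ge 0$ vertices. *Chordal graphs.* The class of chordal graphs is the smallest class of objects of $\mathbf{Gr}$ that contains every graph isomorphic to some $K_n$ ($n\geq 0$), and contains $H$ whenever $H\cong H_1+_{K_n}H_2$ is the pushout in $\mathbf{Gr}$ of a span of monomorphisms $H_1\hookleftarrow K_n\hookrightarrow H_2$ with $H_1$ and $H_2$ chordal. (All chordal graphs are finite.) *Structured decompositions.* For a directed multigraph $G$ (sets $E$, $V$ and maps $s,t\colon E\to V$) let $\int G$ be its category of elements: one object for each vertex, one for each edge, and for each edge $e$ two non-identity morphisms $s(e)\leftarrow e\to t(e)$. A $\mathbf K$-valued structured decomposition of shape $G$ is a functor $d\colon\int G\to\mathbf K$. A morphism $d_1\to d_2$ is a pair $(F,\eta)$ of a functor $F\colon\int G_1\to\int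 G_2$ and a natural transformation $\eta\colon d_1\Rightarrow d_2F$; this gives the category $\mathfrak D\mathbf K$. A 2-cell $(F,\eta)\Rightarrow(F',\eta')$ is a natural transformation $\theta\colon F\Rightarrow F'$ with $\eta'=d_2\theta\circ\eta$. The functor $\mathsf{const}\colon\mathbf K\to\mathfrak D\mathbf K$ sends $x$ to the constant decomposition with value $x$ over the graph with one vertex and no edges. A decomposition is *tree-shaped* if $V$ is finite, $G$ has no loops and no two edges with the same pair of endpoints (in either direction), and the underlying undirected graph of $G$ is a tree. *Gluing.* $\mathrm{Lan}_{\mathsf{const}}\Omega\colon\mathfrak D\,\mathbf{FinSet}\to\mathbf{Gr}$ is the functor $d\mapsto\mathrm{colim}(\Omega\circ d)$, i.e. the composite $\mathfrak D\,\mathbf{FinSet}\xrightarrow{\mathfrak D\Omega}\mathfrak D\,\mathbf{Gr}\xrightarrow{\mathrm{colim}}\mathbf{Gr}$. **Proposition.** 1. $\mathrm{Lan}_{\mathsf{const}}\Omega$ is a left Kan extension of $\Omega$ along $\mathsf{const}$ in the following (2-categorical) sense: it sends morphisms connected by a 2-cell to equal morphisms, and there is a natural transformation $\alpha\colon\Omega\Rightarrow(\mathrm{Lan}_{\mathsf{const}}\Omega)\circ\mathsf{const}$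 such that, for every functor $M\colon\mathfrak D\,\mathbf{FinSet}\to\mathbf{Gr}$ that sends morphisms connected by a 2-cell to equal morphisms and every $\beta\colon\Omega\Rightarrow M\circ\mathsf{const}$, there is a unique $\gamma\colon\mathrm{Lan}_{\mathsf{const}}\Omega\Rightarrow M$ with $(\gamma\,\mathsf{const})\circ\alpha=\beta$. 2. For every tree-shaped decomposition $\tau\colon\int T\to\mathbf{FinSet}$, the graph $(\mathrm{Lan}_{\mathsf{const}}\Omega)(\tau)$ is chordal. 3. Conversely, for every chordal graph $H$ there is at least one tree-shaped decomposition $\tau\colon\int T\to\mathbf{FinSet}$ with $(\mathrm{Lan}_{\mathsf{const}}\Omega)(\tau)\cong H$. -/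

import Mathlib

open CategoryTheory CategoryTheory.Limits

universe u v w

/-! ### The category of undirected reflexive graphs -/

/-- An undirected, reflexive graph without parallel edges: a vertex set with a simple graph on it,
every vertex being thought of as carrying an (implicit) loop. -/
structure ReflGraph : Type (u + 1) where
  verts : Type u
  graph : SimpleGraph verts

namespace ReflGraph

/-- A homomorphism of reflexive graphs: the endpoints of an edge are sent to the endpoints of an
edge or to one and the same vertex (the edge is sent to the implicit loop). -/
@[ext]
structure Hom (G H : ReflGraph.{u}) : Type u where
  toFun : G.verts → H.verts
  map_adj : ∀ x y, G.graph.Adj x y → toFun x = toFun y ∨ H.graph.Adj (toFun x) (toFun y)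

instance : Category.{u} ReflGraph.{u} where
  Hom := Hom
  id G := ⟨fun x => x, fun _ _ h => Or.inr h⟩
  comp {_ _ _} f g := ⟨fun x => g.toFun (f.toFun x), fun x y h => by
    rcases f.map_adj x y h with e | e
    · exact Or.inl (congrArg g.toFun e)
    · exact g.map_adj _ _ e⟩

@[ext]
theorem hom_ext {G H : ReflGraph.{u}} {f g : G ⟶ H} (h : ∀ x, f.toFun x = g.toFun x) : f = g :=
  Hom.ext (funext h)

@[simp]
theorem id_toFun (G : ReflGraph.{u}) (x : G.verts) : Hom.toFun (𝟙 G) x = x := rfl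

@[simp]
theorem comp_toFun {G H K : ReflGraph.{u}} (f : G ⟶ H) (g : H ⟶ K) (x : G.verts) :
    (f ≫ g).toFun x = g.toFun (f.toFun x) := rfl

/-- The vertex-set functor. -/
def vertsFunctor : ReflGraph.{u} ⥤ Type u where
  obj G := G.verts
  map f := ↾f.toFun

/-- The colimit cocone of a diagram of reflexive graphs: the vertices are the colimit of the vertex
sets, and two distinct vertices are adjacent when they are the images of adjacent vertices of some
graph in the diagram. -/
def colimitCocone {J : Type u} [Category.{v} J] (D : J ⥤ ReflGraph.{u}) : Cocone D where
  pt :=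
    { verts := (D ⋙ vertsFunctor).ColimitType
      graph := SimpleGraph.fromRel fun x y => ∃ (j : J) (a b : (D.obj j).verts),
        (D.obj j).graph.Adj a b ∧ (D ⋙ vertsFunctor).ιColimitType j a = x ∧
          (D ⋙ vertsFunctor).ιColimitType j b = y }
  ι :=
    { app := fun j => ⟨fun a => (D ⋙ vertsFunctor).ιColimitType j a, fun a b h => by
        by_cases e : (D ⋙ vertsFunctor).ιColimitType j a = (D ⋙ vertsFunctor).ιColimitType j b
        · exact Or.inl e
        · exact Or.inr ⟨e, Or.inl ⟨j, a, b, h, rfl, rfl⟩⟩⟩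
      naturality := fun i j f => by
        ext x
        exact (D ⋙ vertsFunctor).ιColimitType_map f x }

/-- The underlying cocone of vertex sets. -/
def coconeTypes {J : Type u} [Category.{v} J] {D : J ⥤ ReflGraph.{u}} (s : Cocone D) :
    (D ⋙ vertsFunctor).CoconeTypes where
  pt := s.pt.verts
  ι j := (s.ι.app j).toFun
  ι_naturality {i j} f := by
    funext x
    exact congrArg (fun g : D.obj i ⟶ s.pt => g.toFun x) (s.w f)

/-- The cocone above is a colimit. -/
def colimitCoconeIsColimit {J : Type u} [Category.{v} J] (D : J ⥤ ReflGraph.{u}) :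
    IsColimit (colimitCocone D) where
  desc s := ⟨(D ⋙ vertsFunctor).descColimitType (coconeTypes s), fun x y h => by
    rcases h.2 with ⟨j, a, b, hab, rfl, rfl⟩ | ⟨j, a, b, hab, rfl, rfl⟩
    · exact (s.ι.app j).map_adj a b hab
    · exact ((s.ι.app j).map_adj a b hab).imp Eq.symm SimpleGraph.Adj.symm⟩
  fac s j := rfl
  uniq s m hm := by
    ext x
    obtain ⟨j, a, rfl⟩ := (D ⋙ vertsFunctor).ιColimitType_jointly_surjective x
    exact congrArg (fun g : D.obj j ⟶ s.pt => g.toFun a) (hm j)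

instance : HasColimitsOfSize.{v, u} ReflGraph.{u} where
  has_colimits_of_shape _ _ :=
    { has_colimit := fun D => ⟨⟨⟨colimitCocone D, colimitCoconeIsColimit D⟩⟩⟩ }

end ReflGraph

/-- The functor sending a finite set to the complete graph on it. -/
def completeGraphFunctor : FintypeCat.{u} ⥤ ReflGraph.{u} where
  obj X := ⟨X.obj, ⊤⟩
  map f := ⟨fun x => f x, fun _ _ _ => or_iff_not_imp_left.mpr fun h => h⟩

/-- The complete graph `K_n` (with `K_0` the empty graph). -/
def cliqueGraph (n : ℕ) : ReflGraph.{u} :=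
  completeGraphFunctor.obj (FintypeCat.of (ULift.{u} (Fin n)))

/-- Chordal graphs: the complete graphs, closed under pushouts, in the category of reflexive
graphs, of monic spans whose apex is a complete graph. All of them are finite. -/
inductive IsChordal : ReflGraph.{u} → Prop
  | complete (n : ℕ) (H : ReflGraph.{u}) (e : H ≅ cliqueGraph n) : IsChordal H
  | glue (n : ℕ) {H₁ H₂ H : ReflGraph.{u}} (f : cliqueGraph n ⟶ H₁) (g : cliqueGraph n ⟶ H₂)
      (i : H₁ ⟶ H) (j : H₂ ⟶ H) (hf : Mono f) (hg : Mono g)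
      (h₁ : IsChordal H₁) (h₂ : IsChordal H₂) (h : IsPushout f g i j) : IsChordal H

/-! ### Shapes of decompositions -/

/-- A graph, as a functor from the category `E ⇉ V` to sets (`zero` is `E`, `one` is `V`).
Its category of elements `G.Elements` is the category `∫ G`, with one object for each edge and for
each vertex, and a span from each edge to its source and its target. -/
abbrev ShapeGraph : Type (u + 1) := WalkingParallelPair ⥤ Type u

namespace ShapeGraph

abbrev Vert (G : ShapeGraph.{u}) : Type u := G.obj WalkingParallelPair.one

abbrev Edge (G : ShapeGraph.{u}) : Type u := G.obj WalkingParallelPair.zero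

def src (G : ShapeGraph.{u}) (e : G.Edge) : G.Vert := G.map WalkingParallelPairHom.left e

def tgt (G : ShapeGraph.{u}) (e : G.Edge) : G.Vert := G.map WalkingParallelPairHom.right e

/-- `G` is a finite tree: it has no loops, at most one edge (in either direction) between two given
vertices, and its underlying undirected simple graph is a tree (so it has a vertex). -/
structure IsFiniteTree (G : ShapeGraph.{u}) : Prop where
  finite : Finite G.Vert
  loopless : ∀ e, G.src e ≠ G.tgt e
  simple : ∀ e e', s(G.src e, G.tgt e) = s(G.src e', G.tgt e') → e = e'
  isTree : (SimpleGraph.fromRel fun x y => ∃ e, G.src e = x ∧ G.tgt e = y).IsTree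

/-- The graph with one vertex and no edges. -/
def point : ShapeGraph.{u} :=
  parallelPair (X := PEmpty.{u + 1}) (Y := PUnit.{u + 1}) (↾PEmpty.elim) (↾PEmpty.elim)

end ShapeGraph

/-! ### Structured decompositions -/

/-- A `K`-valued structured decomposition: a graph `G` and a functor `∫ G ⥤ K`. -/
structure StrDecomp (K : Type w) [Category.{v} K] : Type (max (u + 1) v w) where
  shape : ShapeGraph.{u}
  diagram : shape.Elements ⥤ K

namespace StrDecomp

variable {K : Type*} [Category* K] {C : Type*} [Category* C]

/-- A morphism `(F, η)` of structured decompositions. -/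
structure Hom (d₁ d₂ : StrDecomp.{u} K) where
  base : d₁.shape.Elements ⥤ d₂.shape.Elements
  nat : d₁.diagram ⟶ base ⋙ d₂.diagram

/-- The category `sd K` of structured decompositions. -/
instance : Category (StrDecomp.{u} K) where
  Hom := Hom
  id d := ⟨𝟭 _, 𝟙 d.diagram⟩
  comp f g := ⟨f.base ⋙ g.base, f.nat ≫ Functor.whiskerLeft f.base g.nat⟩
  id_comp f := congrArg (Hom.mk f.base) (by ext; exact Category.id_comp _)
  comp_id f := congrArg (Hom.mk f.base) (by ext; exact Category.comp_id _)
  assoc f g h := congrArg (Hom.mk (f.base ⋙ g.base ⋙ h.base)) (by ext; exact Category.assoc _ _ _)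

/-- The functor `sd Ω : sd K ⥤ sd C`, composing decompositions with `Ω : K ⥤ C`. -/
abbrev map (Ω : K ⥤ C) : StrDecomp.{u} K ⥤ StrDecomp.{u} C where
  obj d := ⟨d.shape, d.diagram ⋙ Ω⟩
  map f := ⟨f.base, Functor.whiskerRight f.nat Ω⟩
  map_id d := congrArg (Hom.mk (d₁ := ⟨d.shape, d.diagram ⋙ Ω⟩) (d₂ := ⟨d.shape, d.diagram ⋙ Ω⟩)
    (𝟭 d.shape.Elements)) (by ext j; exact Ω.map_id (d.diagram.obj j))
  map_comp {d₁ _ d₃} f g := congrArg (Hom.mk (d₁ := ⟨d₁.shape, d₁.diagram ⋙ Ω⟩)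
    (d₂ := ⟨d₃.shape, d₃.diagram ⋙ Ω⟩) (f.base ⋙ g.base))
    (by ext j; exact Ω.map_comp (f.nat.app j) (g.nat.app (f.base.obj j)))

/-- The functor `colim : sd C ⥤ C`, taking a decomposition to the colimit of its diagram. -/
noncomputable abbrev colim [HasColimitsOfSize.{0, u} C] : StrDecomp.{u} C ⥤ C where
  obj d := colimit d.diagram
  map {d₁ d₂} f := colimMap f.nat ≫ colimit.pre d₂.diagram f.base
  map_id d := colimit.hom_ext fun j => by
    rw [ι_colimMap_assoc]
    exact (congrArg (_ ≫ ·) (colimit.ι_pre d.diagram (𝟭 _) j)).trans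
      ((Category.id_comp _).trans (Category.comp_id _).symm)
  map_comp {d₁ d₂ d₃} f g := colimit.hom_ext fun j => by
    have h₁ : colimit.ι d₁.diagram j ≫ colimMap (f ≫ g).nat ≫
        colimit.pre d₃.diagram (f ≫ g).base =
        (f.nat.app j ≫ g.nat.app (f.base.obj j)) ≫
          colimit.ι d₃.diagram (g.base.obj (f.base.obj j)) := by
      rw [ι_colimMap_assoc]
      exact congrArg (_ ≫ ·) (colimit.ι_pre d₃.diagram _ j)
    have h₂ : colimit.ι d₁.diagram j ≫ (colimMap f.nat ≫ colimit.pre d₂.diagram f.base) ≫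
        colimMap g.nat ≫ colimit.pre d₃.diagram g.base =
        f.nat.app j ≫ g.nat.app (f.base.obj j) ≫
          colimit.ι d₃.diagram (g.base.obj (f.base.obj j)) := by
      rw [Category.assoc, ι_colimMap_assoc, colimit.ι_pre_assoc, ι_colimMap_assoc]
      exact congrArg (fun t => f.nat.app j ≫ g.nat.app (f.base.obj j) ≫ t)
        (colimit.ι_pre d₃.diagram g.base (f.base.obj j))
    rw [h₁, h₂, Category.assoc]

/-- The functor `const : K ⥤ sd K`, taking an object `x` to the constant diagram with value `x`
over the graph with one vertex and no edges. -/
abbrev const (K : Type*) [Category* K] : K ⥤ StrDecomp.{u} K where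
  obj x := ⟨ShapeGraph.point, (Functor.const _).obj x⟩
  map {_ _} f := ⟨𝟭 _, (Functor.const _).map f⟩
  map_id _ := rfl
  map_comp _ _ := rfl

/-- `Lan_const Ω : sd K ⥤ C`, the composite of `sd Ω` and `colim`. -/
noncomputable abbrev lanConst [HasColimitsOfSize.{0, u} C] (Ω : K ⥤ C) : StrDecomp.{u} K ⥤ C :=
  map Ω ⋙ colim

/-- There is a 2-cell `(F, η) ⟶ (F', η')`: a natural transformation `θ : F ⟶ F'` such that
`η' = d₂ θ ∘ η`. -/
def HasTwoCell {d₁ d₂ : StrDecomp.{u} K} (f g : d₁ ⟶ d₂) : Prop :=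
  ∃ θ : f.base ⟶ g.base, f.nat ≫ Functor.whiskerRight θ d₂.diagram = g.nat

/-- A functor `M : sd K ⥤ C` sends 2-cells to equalities; that is, `M` is a 2-functor if `C` is
seen as a 2-category with only identity 2-cells. -/
def RespectsTwoCells (M : StrDecomp.{u} K ⥤ C) : Prop :=
  ∀ ⦃d₁ d₂ : StrDecomp.{u} K⦄ (f g : d₁ ⟶ d₂), HasTwoCell f g → M.map f = M.map g

/-- `(L, α)` is a left Kan extension of `Ω : K ⥤ C` along `const`, where `sd K` is seen as a
2-category: `L` is a 2-functor, and `α` is universal among natural transformations from `Ω` to the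
restriction of a 2-functor `M : sd K ⥤ C` along `const`. -/
def IsLanConst (Ω : K ⥤ C) (L : StrDecomp.{u} K ⥤ C) (α : Ω ⟶ const K ⋙ L) : Prop :=
  RespectsTwoCells L ∧
    ∀ M : StrDecomp.{u} K ⥤ C, RespectsTwoCells M → ∀ β : Ω ⟶ const K ⋙ M,
      ∃! γ : L ⟶ M, α ≫ Functor.whiskerLeft (const K) γ = β

end StrDecomp

/-! Universal property: each object `j` of the shape of `d` gives a morphism `pick d j` from a
constant decomposition to `d`, and each arrow of the shape gives a 2-cell between such morphisms. If
`M` collapses 2-cells, the maps `β` followed by `M.map (pick d j)` form a cocone over `Ω ∘ d`, which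
descends to the colimit. Uniqueness holds because each colimit leg is the unit followed by the image
of `pick d j`.

Trees give chordal graphs: the images of the vertex graphs in the colimit (the bags) form a clique
tree (`isCliqueTree_bag`). Two bags sharing a point are linked by a walk of bags containing it, and
in a tree every such walk covers the path. Removing a leaf bag exhibits the colimit as a smaller
clique tree glued to a complete graph along a clique (`IsCliqueTree.isChordal`). Bags are images, so
the maps of the decomposition need not be injective.

Chordal graphs come from trees: induction on the gluing construction, with the stronger claim that
every clique lies in one bag. Each leg of a span out of `K_n` then factors through a bag, so the two
trees can be joined by one new edge with value `K_n`; the colimit of the join is the pushout. The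
stronger claim survives because a clique of a pushout along a complete graph lies on one side and is
already a clique there. -/

/-! ### The universal property of gluing -/

namespace ShapeGraph

/-- The only object of the category of elements of the one-vertex graph. -/
abbrev pointElement : point.{u}.Elements := ⟨WalkingParallelPair.one, PUnit.unit⟩

theorem eq_pointElement : ∀ j : point.{u}.Elements, j = pointElement
  | ⟨.zero, x⟩ => PEmpty.elim x
  | ⟨.one, _⟩ => rfl

theorem eq_id_of_one : ∀ f : WalkingParallelPair.one ⟶ WalkingParallelPair.one, f = 𝟙 _
  | .id _ => rfl

end ShapeGraph

namespace StrDecomp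

variable {K : Type*} [Category* K] {C : Type*} [Category* C]

/-- The morphism from a constant decomposition that picks the object `j` of the shape of `d`. -/
def pick (d : StrDecomp.{u} K) (j : d.shape.Elements) : (const K).obj (d.diagram.obj j) ⟶ d :=
  Hom.mk ((Functor.const _).obj j) { app := fun _ => 𝟙 _ }

/-- This 2-cell is what makes the family `β.app _ ≫ M.map (pick d j)` compatible with the arrows of
the shape. -/
theorem hasTwoCell_pick_map {d : StrDecomp.{u} K} {j k : d.shape.Elements} (f : j ⟶ k) :
    HasTwoCell (pick d j) ((const K).map (d.diagram.map f) ≫ pick d k) := by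
  refine ⟨{ app := fun _ => f, naturality := ?_ }, ?_⟩
  · intro a b g
    exact (Category.id_comp f).trans (Category.comp_id f).symm
  · apply NatTrans.ext
    funext t
    exact (Category.id_comp _).trans (Category.comp_id _).symm

/-- Both bases are constant at `f.base.obj j`, so identities form a 2-cell; no equality of functors
is needed. It gives naturality of `lanDesc`. -/
theorem hasTwoCell_pick_comp {d₁ d₂ : StrDecomp.{u} K} (f : d₁ ⟶ d₂) (j : d₁.shape.Elements) :
    HasTwoCell (pick d₁ j ≫ f) ((const K).map (f.nat.app j) ≫ pick d₂ (f.base.obj j)) := by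
  refine ⟨{ app := fun _ => 𝟙 (f.base.obj j), naturality := ?_ }, ?_⟩
  · intro a b g
    exact congrArg (· ≫ 𝟙 (f.base.obj j)) (f.base.map_id j)
  · apply NatTrans.ext
    funext t
    have h : (𝟙 (d₁.diagram.obj j) ≫ f.nat.app j) ≫ d₂.diagram.map (𝟙 (f.base.obj j)) =
        f.nat.app j ≫ 𝟙 (d₂.diagram.obj (f.base.obj j)) := by simp
    exact h

theorem hasTwoCell_pick_const (x : K) :
    HasTwoCell (pick ((const.{u} K).obj x) ShapeGraph.pointElement) (𝟙 _) := by
  refine ⟨{ app := fun j => eqToHom (ShapeGraph.eq_pointElement j).symm, naturality := ?_ }, ?_⟩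
  · intro a b g
    obtain rfl := ShapeGraph.eq_pointElement a
    obtain rfl := ShapeGraph.eq_pointElement b
    refine (Category.id_comp _).trans (Eq.trans ?_ (Category.id_comp _).symm)
    obtain ⟨g, hg⟩ := g
    obtain rfl := ShapeGraph.eq_id_of_one g
    rfl
  · apply NatTrans.ext
    funext t
    exact Category.comp_id (𝟙 x)

variable [HasColimitsOfSize.{0, u} C]

theorem ι_lanConst_map (Ω : K ⥤ C) {d₁ d₂ : StrDecomp.{u} K} (f : d₁ ⟶ d₂)
    (j : d₁.shape.Elements) :
    colimit.ι (d₁.diagram ⋙ Ω) j ≫ (lanConst Ω).map f =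
      Ω.map (f.nat.app j) ≫ colimit.ι (d₂.diagram ⋙ Ω) (f.base.obj j) :=
  (ι_colimMap_assoc _ _ _).trans
    (congrArg (Ω.map (f.nat.app j) ≫ ·) (colimit.ι_pre (d₂.diagram ⋙ Ω) f.base j))

theorem lanConst_respectsTwoCells (Ω : K ⥤ C) : RespectsTwoCells (lanConst.{u} Ω) := by
  rintro d₁ d₂ f g ⟨θ, hθ⟩
  refine colimit.hom_ext fun j => ?_
  have h : f.nat.app j ≫ d₂.diagram.map (θ.app j) = g.nat.app j :=
    congrArg (fun t => NatTrans.app t j) hθ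
  refine (ι_lanConst_map Ω f j).trans (Eq.trans ?_ (ι_lanConst_map Ω g j).symm)
  rw [← h, Ω.map_comp, Category.assoc]
  exact congrArg (_ ≫ ·) (colimit.w (d₂.diagram ⋙ Ω) (θ.app j)).symm

/-- The universal transformation `Ω ⟶ const ⋙ Lan_const Ω`. -/
noncomputable def lanUnit (Ω : K ⥤ C) : Ω ⟶ const.{u} K ⋙ lanConst Ω where
  app x := colimit.ι (((const.{u} K).obj x).diagram ⋙ Ω) ShapeGraph.pointElement
  naturality _ _ f := (ι_lanConst_map Ω ((const.{u} K).map f) ShapeGraph.pointElement).symm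

theorem lanUnit_app_map_pick (Ω : K ⥤ C) (d : StrDecomp.{u} K) (j : d.shape.Elements) :
    (lanUnit Ω).app (d.diagram.obj j) ≫ (lanConst Ω).map (pick d j) =
      colimit.ι (d.diagram ⋙ Ω) j :=
  (ι_lanConst_map Ω (pick d j) ShapeGraph.pointElement).trans
    ((congrArg (· ≫ colimit.ι (d.diagram ⋙ Ω) j) (Ω.map_id _)).trans (Category.id_comp _))

section

variable {Ω : K ⥤ C} {M : StrDecomp.{u} K ⥤ C} (hM : RespectsTwoCells M)
  (β : Ω ⟶ const.{u} K ⋙ M)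

/-- The cocone over `Ω ∘ d` with apex `M d` that `β` induces. -/
def lanCocone (d : StrDecomp.{u} K) : Cocone (d.diagram ⋙ Ω) where
  pt := M.obj d
  ι :=
    { app := fun j => β.app (d.diagram.obj j) ≫ M.map (pick d j)
      naturality := fun j k f => by
        have h₁ := β.naturality (d.diagram.map f)
        have h₂ := (hM _ _ (hasTwoCell_pick_map f)).trans (M.map_comp _ _)
        refine Eq.trans ?_ (Category.comp_id _).symm
        rw [h₂]
        exact (Category.assoc _ _ _).symm.trans
          ((congrArg (· ≫ M.map (pick d k)) h₁).trans (Category.assoc _ _ _)) }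

/-- The transformation `Lan_const Ω ⟶ M` that `β` induces. -/
noncomputable def lanDesc : lanConst Ω ⟶ M where
  app d := colimit.desc (d.diagram ⋙ Ω) (lanCocone hM β d)
  naturality d₁ d₂ f := by
    refine colimit.hom_ext fun j => ?_
    have h₁ := β.naturality (f.nat.app j)
    have h₂ := (M.map_comp _ _).symm.trans ((hM _ _ (hasTwoCell_pick_comp f j)).trans
      (M.map_comp _ _))
    have h₃ : colimit.ι (d₁.diagram ⋙ Ω) j ≫ (lanConst Ω).map f ≫
        colimit.desc (d₂.diagram ⋙ Ω) (lanCocone hM β d₂) = Ω.map (f.nat.app j) ≫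
          β.app (d₂.diagram.obj (f.base.obj j)) ≫ M.map (pick d₂ (f.base.obj j)) := by
      rw [← Category.assoc, ι_lanConst_map, Category.assoc, colimit.ι_desc]
      rfl
    have h₄ := (colimit.ι_desc_assoc (lanCocone hM β d₁) j (M.map f)).trans
      (Category.assoc (β.app (d₁.diagram.obj j)) (M.map (pick d₁ j)) (M.map f))
    refine h₃.trans (Eq.trans ?_ h₄.symm)
    rw [h₂]
    exact (Category.assoc _ _ _).symm.trans
      ((congrArg (· ≫ M.map (pick d₂ (f.base.obj j))) h₁).trans (Category.assoc _ _ _))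

theorem lanUnit_lanDesc :
    lanUnit Ω ≫ Functor.whiskerLeft (const.{u} K) (lanDesc hM β) = β := by
  apply NatTrans.ext
  funext x
  have h := (hM _ _ (hasTwoCell_pick_const.{u} x)).trans (M.map_id _)
  refine (colimit.ι_desc (lanCocone hM β ((const.{u} K).obj x)) ShapeGraph.pointElement).trans ?_
  exact (congrArg (β.app x ≫ ·) h).trans (Category.comp_id _)

/-- By `lanUnit_app_map_pick` and naturality, the restriction of a transformation to constant
decompositions determines it on every colimit leg. -/
theorem lanConst_hom_ext {γ γ' : lanConst Ω ⟶ M}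
    (h : lanUnit Ω ≫ Functor.whiskerLeft (const.{u} K) γ =
      lanUnit Ω ≫ Functor.whiskerLeft (const.{u} K) γ') : γ = γ' := by
  apply NatTrans.ext
  funext d
  refine colimit.hom_ext fun j => ?_
  have key : ∀ δ : lanConst Ω ⟶ M, colimit.ι (d.diagram ⋙ Ω) j ≫ δ.app d =
      (lanUnit Ω ≫ Functor.whiskerLeft (const.{u} K) δ).app (d.diagram.obj j) ≫
        M.map (pick d j) := fun δ => by
    rw [← lanUnit_app_map_pick, Category.assoc, δ.naturality]
    exact (Category.assoc _ _ _).symm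
  rw [key, key, h]

end

theorem isLanConst_lanUnit (Ω : K ⥤ C) : IsLanConst Ω (lanConst.{u} Ω) (lanUnit Ω) :=
  ⟨lanConst_respectsTwoCells Ω, fun _ hM β =>
    ⟨lanDesc hM β, lanUnit_lanDesc hM β,
      fun _ h => lanConst_hom_ext (h.trans (lanUnit_lanDesc hM β).symm)⟩⟩

end StrDecomp

/-! ### Gluing induced subgraphs, and clique trees -/

namespace ReflGraph

/-- The induced subgraph on a set of vertices. -/
def induce (H : ReflGraph.{u}) (S : Set H.verts) : ReflGraph.{u} := ⟨S, H.graph.induce S⟩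

/-- The inclusion of an induced subgraph. -/
def induceIncl (H : ReflGraph.{u}) (S : Set H.verts) : H.induce S ⟶ H :=
  Hom.mk Subtype.val fun _ _ h => Or.inr h

/-- The inclusion between induced subgraphs. -/
def induceInclOfLE (H : ReflGraph.{u}) {S T : Set H.verts} (h : S ⊆ T) :
    H.induce S ⟶ H.induce T :=
  Hom.mk (Set.inclusion h) fun _ _ h => Or.inr h

theorem mono_of_injective {G H : ReflGraph.{u}} (f : G ⟶ H) (hf : Function.Injective f.toFun) :
    Mono f :=
  ⟨fun _ _ e => hom_ext fun x => hf (congrArg (fun t : _ ⟶ H => t.toFun x) e)⟩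

/-- Two induced subgraphs that cover all vertices and edges are glued along their intersection. -/
theorem isPushout_induce (H : ReflGraph.{u}) (S T : Set H.verts) (hv : ∀ x, x ∈ S ∨ x ∈ T)
    (he : ∀ x y, H.graph.Adj x y → (x ∈ S ∧ y ∈ S) ∨ (x ∈ T ∧ y ∈ T)) :
    IsPushout (H.induceInclOfLE Set.inter_subset_left)
      (H.induceInclOfLE (Set.inter_subset_right : S ∩ T ⊆ T)) (H.induceIncl S)
      (H.induceIncl T) := by
  classical
  have hcond : ∀ (s : PushoutCocone (H.induceInclOfLE (Set.inter_subset_left : S ∩ T ⊆ S))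
      (H.induceInclOfLE (Set.inter_subset_right : S ∩ T ⊆ T))) x (h₁ : x ∈ S) (h₂ : x ∈ T),
      s.inl.toFun ⟨x, h₁⟩ = s.inr.toFun ⟨x, h₂⟩ := fun s x h₁ h₂ =>
    congrArg (fun t : H.induce (S ∩ T) ⟶ s.pt => t.toFun ⟨x, h₁, h₂⟩) s.condition
  refine ⟨⟨rfl⟩, ⟨PushoutCocone.IsColimit.mk _ (fun s => ?_) ?_ ?_ ?_⟩⟩
  · refine Hom.mk (fun x => if h : x ∈ S then s.inl.toFun ⟨x, h⟩
      else s.inr.toFun ⟨x, (hv x).resolve_left h⟩) fun x y hxy => ?_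
    -- The two legs agree on the overlap, so the glued map is `inr` on all of `T`, even where its
    -- definition takes the `inl` branch.
    have key : ∀ x (h : x ∈ T), (if h : x ∈ S then s.inl.toFun ⟨x, h⟩
        else s.inr.toFun ⟨x, (hv x).resolve_left h⟩) = s.inr.toFun ⟨x, h⟩ := fun x h => by
      split_ifs with h'
      · exact hcond s x h' h
      · rfl
    rcases he x y hxy with ⟨hx, hy⟩ | ⟨hx, hy⟩
    · simp only [hx, hy, dif_pos]
      exact s.inl.map_adj ⟨x, hx⟩ ⟨y, hy⟩ hxy
    · simp only [key x hx, key y hy]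
      exact s.inr.map_adj ⟨x, hx⟩ ⟨y, hy⟩ hxy
  · intro s
    ext ⟨x, hx⟩
    exact dif_pos hx
  · intro s
    ext ⟨x, hx⟩
    by_cases h : x ∈ S
    · exact (dif_pos h).trans (hcond s x h hx)
    · exact dif_neg h
  · intro s m h₁ h₂
    ext x
    by_cases h : x ∈ S
    · exact ((dif_pos h).trans
        (congrArg (fun t : H.induce S ⟶ s.pt => t.toFun ⟨x, h⟩) h₁).symm).symm
    · exact ((dif_neg h).trans (congrArg
        (fun t : H.induce T ⟶ s.pt => t.toFun ⟨x, (hv x).resolve_left h⟩) h₂).symm).symm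

/-- A finite graph all of whose vertices are adjacent is a complete graph. -/
theorem exists_iso_cliqueGraph (H : ReflGraph.{u}) [Finite H.verts]
    (h : ∀ x y, x ≠ y → H.graph.Adj x y) : ∃ n, Nonempty (H ≅ cliqueGraph n) := by
  let e : H.verts ≃ ULift.{u} (Fin (Nat.card H.verts)) :=
    (Finite.equivFin H.verts).trans Equiv.ulift.symm
  exact ⟨Nat.card H.verts, ⟨{
    hom := Hom.mk e fun x y _ => or_iff_not_imp_left.mpr fun h => h
    inv := Hom.mk e.symm fun x y _ => or_iff_not_imp_left.mpr fun h' => h _ _ h'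
    hom_inv_id := hom_ext fun x => e.symm_apply_apply x
    inv_hom_id := hom_ext fun x => e.apply_symm_apply x }⟩⟩

end ReflGraph

theorem IsChordal.of_iso {G H : ReflGraph.{u}} (h : IsChordal G) (e : G ≅ H) : IsChordal H := by
  cases h with
  | complete n _ e' => exact .complete n H (e.symm ≪≫ e')
  | glue n f g i j hf hg h₁ h₂ h =>
    exact .glue n f g (i ≫ e.hom) (j ≫ e.hom) hf hg h₁ h₂
      (h.of_iso (Iso.refl _) (Iso.refl _) (Iso.refl _) e (by simp) (by simp) (by simp) (by simp))

theorem IsChordal.of_complete {H : ReflGraph.{u}} [Finite H.verts]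
    (h : ∀ x y, x ≠ y → H.graph.Adj x y) : IsChordal H := by
  obtain ⟨n, ⟨e⟩⟩ := H.exists_iso_cliqueGraph h
  exact .complete n H e

/-- A union of two chordal induced subgraphs whose intersection is a clique is chordal. -/
theorem IsChordal.of_induce {H : ReflGraph.{u}} [Finite H.verts] {S T : Set H.verts}
    (hS : IsChordal (H.induce S)) (hT : IsChordal (H.induce T)) (hv : ∀ x, x ∈ S ∨ x ∈ T)
    (he : ∀ x y, H.graph.Adj x y → (x ∈ S ∧ y ∈ S) ∨ (x ∈ T ∧ y ∈ T))
    (hc : ∀ x y, x ∈ S → x ∈ T → y ∈ S → y ∈ T → x ≠ y → H.graph.Adj x y) : IsChordal H := by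
  have : Finite (H.induce (S ∩ T)).verts := inferInstanceAs (Finite ↥(S ∩ T))
  obtain ⟨n, ⟨e⟩⟩ := (H.induce (S ∩ T)).exists_iso_cliqueGraph fun x y h =>
    hc x.1 y.1 x.2.1 x.2.2 y.2.1 y.2.2 fun h' => h (Subtype.ext h')
  have h₁ := ReflGraph.mono_of_injective (H.induceInclOfLE (Set.inter_subset_left : S ∩ T ⊆ S))
    (Set.inclusion_injective Set.inter_subset_left)
  have h₂ := ReflGraph.mono_of_injective (H.induceInclOfLE (Set.inter_subset_right : S ∩ T ⊆ T))
    (Set.inclusion_injective Set.inter_subset_right)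
  exact .glue n (e.inv ≫ H.induceInclOfLE Set.inter_subset_left)
    (e.inv ≫ H.induceInclOfLE Set.inter_subset_right) (H.induceIncl S) (H.induceIncl T)
    (mono_comp _ _) (mono_comp _ _) hS hT
    ((H.isPushout_induce S T hv he).of_iso e (Iso.refl _) (Iso.refl _) (Iso.refl _)
      (by simp) (by simp) (by simp) (by simp))

/-- A tree decomposition of `H` into cliques: the bags cover the vertices, two distinct vertices
are adjacent if and only if they lie in a common bag, and the bags that contain a given vertex form
a subtree. -/
structure IsCliqueTree {V : Type*} (T : SimpleGraph V) (H : ReflGraph.{u})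
    (A : V → Set H.verts) : Prop where
  isTree : T.IsTree
  cover : ∀ x, ∃ t, x ∈ A t
  adj_iff : ∀ x y, H.graph.Adj x y ↔ x ≠ y ∧ ∃ t, x ∈ A t ∧ y ∈ A t
  mem_of_mem_support : ∀ ⦃s t⦄ (p : T.Walk s t), p.IsPath → ∀ x, x ∈ A s → x ∈ A t →
    ∀ r ∈ p.support, x ∈ A r

/-- Removing a leaf of a clique tree. -/
theorem IsCliqueTree.induce_compl_leaf {V : Type*} {T : SimpleGraph V} {H : ReflGraph.{u}}
    {A : V → Set H.verts} (h : IsCliqueTree T H A) {l m : V} (hlm : l ≠ m)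
    (hT : (T.induce {l}ᶜ).IsTree)
    (hm : ∀ x, x ∈ A l → (∃ t, t ≠ l ∧ x ∈ A t) → x ∈ A m) :
    IsCliqueTree (T.induce {l}ᶜ) (H.induce {x | ∃ t, t ≠ l ∧ x ∈ A t})
      (fun t => {x | x.1 ∈ A t.1}) where
  isTree := hT
  cover := fun ⟨_, t, ht, hx⟩ => ⟨⟨t, ht⟩, hx⟩
  adj_iff := fun x y => by
    have key : (∃ t, x.1 ∈ A t ∧ y.1 ∈ A t) ↔
        ∃ t : ({l}ᶜ : Set V), x.1 ∈ A t.1 ∧ y.1 ∈ A t.1 := by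
      constructor
      · rintro ⟨t, hx, hy⟩
        -- If the common bag is the removed one, both vertices also lie in the bag of its neighbour
        -- `m`.
        by_cases ht : t = l
        · subst ht
          exact ⟨⟨m, hlm.symm⟩, hm _ hx x.2, hm _ hy y.2⟩
        · exact ⟨⟨t, ht⟩, hx, hy⟩
      · rintro ⟨t, hx, hy⟩
        exact ⟨t.1, hx, hy⟩
    exact (h.adj_iff x.1 y.1).trans (and_congr (not_congr Subtype.ext_iff.symm) key)
  mem_of_mem_support := fun s t p hp x hs ht r hr => by
    refine h.mem_of_mem_support (p.map (SimpleGraph.Embedding.induce _).toHom)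
      (hp.map Subtype.val_injective) x.1 hs ht r.1 ?_
    rw [SimpleGraph.Walk.support_map]
    exact List.mem_map.mpr ⟨r, hr, rfl⟩

/-- Induction on the number of bags, splitting off a leaf `l` with neighbour `m`. The overlap with
the rest is a clique simply because it lies in `A l`; its inclusion in `A m` ensures that the
remaining bags still account for every edge among the remaining vertices. -/
theorem IsCliqueTree.isChordal {V : Type*} [Finite V] {T : SimpleGraph V} {H : ReflGraph.{u}}
    [Finite H.verts] {A : V → Set H.verts} (h : IsCliqueTree T H A) : IsChordal H := by
  classical
  induction hn : Nat.card V using Nat.strong_induction_on generalizing V H with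
  | _ n ih =>
    subst hn
    have := Fintype.ofFinite V
    have hcl : ∀ t x y, x ∈ A t → y ∈ A t → x ≠ y → H.graph.Adj x y := fun t x y hx hy hxy =>
      (h.adj_iff x y).mpr ⟨hxy, t, hx, hy⟩
    rcases subsingleton_or_nontrivial V with hV | hV
    · refine .of_complete fun x y hxy => ?_
      obtain ⟨s, hs⟩ := h.cover x
      obtain ⟨t, ht⟩ := h.cover y
      obtain rfl := Subsingleton.elim s t
      exact hcl s x y hs ht hxy
    · obtain ⟨l, hl⟩ := h.isTree.exists_vert_degree_one_of_nontrivial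
      obtain ⟨m, hlm, hu⟩ := SimpleGraph.degree_eq_one_iff_existsUnique_adj.mp hl
      have hm : ∀ x, x ∈ A l → (∃ t, t ≠ l ∧ x ∈ A t) → x ∈ A m := by
        rintro x hx ⟨t, ht, hxt⟩
        -- A path leaving the leaf must go through its only neighbour `m`.
        obtain ⟨p, hp, -⟩ := h.isTree.existsUnique_path l t
        have hnil : ¬ p.Nil := SimpleGraph.Walk.not_nil_of_ne ht.symm
        have hs := hu _ (p.adj_snd hnil)
        exact h.mem_of_mem_support p hp x hx hxt m (hs ▸ p.getVert_mem_support 1)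
      have h' := h.induce_compl_leaf hlm.ne
        ⟨h.isTree.connected.induce_compl_singleton_of_degree_eq_one hl,
          h.isTree.isAcyclic.induce _⟩ hm
      have : Finite (H.induce {x | ∃ t, t ≠ l ∧ x ∈ A t}).verts :=
        inferInstanceAs (Finite ↥{x | ∃ t, t ≠ l ∧ x ∈ A t})
      have : Finite (H.induce (A l)).verts := inferInstanceAs (Finite ↥(A l))
      have hcard : Nat.card ({l}ᶜ : Set V) < Nat.card V := by
        rw [Nat.card_eq_fintype_card, Nat.card_eq_fintype_card]
        exact Fintype.card_subtype_lt (x := l) fun h => h rfl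
      refine .of_induce (ih _ hcard h' rfl) (T := A l)
        (.of_complete fun x y hxy => hcl l x.1 y.1 x.2 y.2 fun e => hxy (Subtype.ext e)) ?_ ?_ ?_
      · intro x
        obtain ⟨t, ht⟩ := h.cover x
        by_cases e : t = l
        · exact Or.inr (e ▸ ht)
        · exact Or.inl ⟨t, e, ht⟩
      · intro x y hxy
        obtain ⟨-, t, hx, hy⟩ := (h.adj_iff x y).mp hxy
        by_cases e : t = l
        · exact Or.inr ⟨e ▸ hx, e ▸ hy⟩
        · exact Or.inl ⟨⟨t, e, hx⟩, ⟨t, e, hy⟩⟩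
      · exact fun x y _ hx _ hy => hcl l x y hx hy

/-! ### The bags of a tree-shaped decomposition -/

namespace ShapeGraph

variable (G : ShapeGraph.{u})

/-- A vertex, as an object of the category of elements. -/
abbrev ofVert (v : G.Vert) : G.Elements := ⟨WalkingParallelPair.one, v⟩

/-- An edge, as an object of the category of elements. -/
abbrev ofEdge (e : G.Edge) : G.Elements := ⟨WalkingParallelPair.zero, e⟩

/-- The morphism from an edge to its source. -/
def toSrc (e : G.Edge) : G.ofEdge e ⟶ G.ofVert (G.src e) := ⟨WalkingParallelPairHom.left, rfl⟩

/-- The morphism from an edge to its target. -/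
def toTgt (e : G.Edge) : G.ofEdge e ⟶ G.ofVert (G.tgt e) := ⟨WalkingParallelPairHom.right, rfl⟩

/-- The underlying undirected graph. -/
abbrev toSimpleGraph : SimpleGraph G.Vert :=
  SimpleGraph.fromRel fun x y => ∃ e, G.src e = x ∧ G.tgt e = y

/-- The vertex below an object of the category of elements, with an edge lying over its source. -/
def base : G.Elements → G.Vert
  | ⟨.one, v⟩ => v
  | ⟨.zero, e⟩ => G.src e

variable {G}

/-- To prove something about morphisms of the category of elements, it is enough to look at
the identities and the two morphisms out of every edge. -/
theorem hom_induction {P : ∀ {j k : G.Elements}, (j ⟶ k) → Prop} (id : ∀ j, P (𝟙 j))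
    (src : ∀ e, P (G.toSrc e)) (tgt : ∀ e, P (G.toTgt e)) {j k : G.Elements} (f : j ⟶ k) :
    P f := by
  obtain ⟨j, x⟩ := j
  obtain ⟨k, y⟩ := k
  obtain ⟨f, hf⟩ := f
  change WalkingParallelPairHom j k at f
  cases f with
  | left =>
    change G.src x = y at hf
    subst hf
    exact src x
  | right =>
    change G.tgt x = y at hf
    subst hf
    exact tgt x
  | id =>
    have h : G.map (𝟙 j) x = x := ConcreteCategory.congr_hom (G.map_id j) x
    obtain rfl : x = y := h.symm.trans hf
    exact id ⟨j, x⟩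

end ShapeGraph

namespace ReflGraph

variable {G : ShapeGraph.{u}} (D : G.Elements ⥤ ReflGraph.{u})

/-- The image in the colimit of the graph at the vertex `v`. -/
def bag (v : G.Vert) : Set (colimitCocone D).pt.verts :=
  Set.range (((colimitCocone D).ι.app (G.ofVert v)).toFun)

variable {D}

theorem ι_mem_bag (j : G.Elements) (x : (D.obj j).verts) :
    ((colimitCocone D).ι.app j).toFun x ∈ bag D (G.base j) := by
  obtain ⟨_ | _, j⟩ := j
  · exact ⟨(D.map (G.toSrc j)).toFun x,
      congrArg (fun f : D.obj (G.ofEdge j) ⟶ (colimitCocone D).pt => f.toFun x)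
        ((colimitCocone D).w (G.toSrc j))⟩
  · exact ⟨x, rfl⟩

theorem ι_mem_bag_of_hom {j k : G.Elements} (f : j ⟶ k) (x : (D.obj j).verts) :
    ((colimitCocone D).ι.app j).toFun x ∈ bag D (G.base k) := by
  rw [← (colimitCocone D).w f]
  exact ι_mem_bag k _

theorem adj_base_or_eq {j k : G.Elements} (f : j ⟶ k) :
    G.base j = G.base k ∨ G.toSimpleGraph.Adj (G.base j) (G.base k) := by
  induction f using ShapeGraph.hom_induction with
  | id j => exact Or.inl rfl
  | src e => exact Or.inl rfl
  | tgt e =>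
    by_cases h : G.src e = G.tgt e
    · exact Or.inl h
    · exact Or.inr ⟨h, Or.inl ⟨e, rfl, rfl⟩⟩

/-- There is a walk from `s` to `t` within the bags that contain `p`. -/
def BagReachable (p : (colimitCocone D).pt.verts) (s t : G.Vert) : Prop :=
  ∃ w : G.toSimpleGraph.Walk s t, ∀ r ∈ w.support, p ∈ bag D r

theorem BagReachable.snoc {p : (colimitCocone D).pt.verts} {s t t' : G.Vert}
    (h : BagReachable p s t) (ht : p ∈ bag D t')
    (hadj : t = t' ∨ G.toSimpleGraph.Adj t t') : BagReachable p s t' := by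
  obtain ⟨w, hw⟩ := h
  rcases hadj with rfl | hadj
  · exact ⟨w, hw⟩
  · refine ⟨w.concat hadj, fun r hr => ?_⟩
    rw [SimpleGraph.Walk.support_concat, List.mem_append,
      List.mem_singleton] at hr
    rcases hr with hr | rfl
    · exact hw r hr
    · exact ht

/-- Representatives of one point of the colimit are linked by a zigzag of diagram maps, and each map
moves the base vertex along at most one edge, between bags containing the point. -/
theorem bagReachable_of_mem {p : (colimitCocone D).pt.verts} {s t : G.Vert} (hs : p ∈ bag D s)
    (ht : p ∈ bag D t) : BagReachable p s t := by
  have key : ∀ (j k : G.Elements) (f : j ⟶ k) (x : (D.obj j).verts),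
      (((colimitCocone D).ι.app j).toFun x = p → BagReachable p s (G.base j)) ↔
      (((colimitCocone D).ι.app k).toFun ((D.map f).toFun x) = p →
        BagReachable p s (G.base k)) := fun j k f x => by
    have e : ((colimitCocone D).ι.app k).toFun ((D.map f).toFun x) =
        ((colimitCocone D).ι.app j).toFun x :=
      congrArg (fun g : D.obj j ⟶ (colimitCocone D).pt => g.toFun x) ((colimitCocone D).w f)
    rw [e]
    refine forall_congr' fun hp => ?_
    subst hp
    exact ⟨fun h => h.snoc (ι_mem_bag_of_hom f x) (adj_base_or_eq f), fun h =>
      h.snoc (ι_mem_bag j x) ((adj_base_or_eq f).imp Eq.symm SimpleGraph.Adj.symm)⟩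
  -- A predicate invariant under the diagram maps is a cocone with apex `Prop`; descending it to the
  -- colimit replaces an induction over zigzags.
  let c : (D ⋙ vertsFunctor).CoconeTypes :=
    { pt := Prop
      ι := fun j x => ((colimitCocone D).ι.app j).toFun x = p → BagReachable p s (G.base j)
      ι_naturality := fun {j k} f => funext fun x => propext (key j k f x).symm }
  let P : (colimitCocone D).pt.verts → Prop := (D ⋙ vertsFunctor).descColimitType c
  obtain ⟨a, ha⟩ := hs
  obtain ⟨b, hb⟩ := ht
  have h₁ : P (((colimitCocone D).ι.app (G.ofVert s)).toFun a) := fun _ =>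
    ⟨.nil, fun r hr => by
      obtain rfl : r = s := List.mem_singleton.mp hr
      exact ⟨a, ha⟩⟩
  have h₂ : P (((colimitCocone D).ι.app (G.ofVert t)).toFun b) := by
    rw [hb, ← ha]
    exact h₁
  exact h₂ hb

theorem isCliqueTree_bag (hG : G.IsFiniteTree)
    (hD : ∀ j (x y : (D.obj j).verts), x ≠ y → (D.obj j).graph.Adj x y) :
    IsCliqueTree G.toSimpleGraph (colimitCocone D).pt (bag D) where
  isTree := hG.isTree
  cover x := by
    obtain ⟨j, a, rfl⟩ := (D ⋙ vertsFunctor).ιColimitType_jointly_surjective x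
    exact ⟨_, ι_mem_bag j a⟩
  adj_iff x y := by
    constructor
    · rintro ⟨hxy, ⟨j, a, b, -, rfl, rfl⟩ | ⟨j, a, b, -, rfl, rfl⟩⟩
      · exact ⟨hxy, _, ι_mem_bag j a, ι_mem_bag j b⟩
      · exact ⟨hxy, _, ι_mem_bag j b, ι_mem_bag j a⟩
    · rintro ⟨hxy, t, ⟨a, rfl⟩, ⟨b, rfl⟩⟩
      exact ⟨hxy, Or.inl ⟨_, a, b, hD _ a b fun h => hxy (h ▸ rfl), rfl, rfl⟩⟩
  mem_of_mem_support s t p hp x hs ht r hr := by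
    classical
    -- The unique path between two vertices of a tree is obtained from any walk between them by
    -- cutting out detours, so its support lies in that of `w`.
    obtain ⟨w, hw⟩ := bagReachable_of_mem hs ht
    have e := (hG.isTree.isAcyclic.subsingleton_path s t).elim ⟨p, hp⟩ w.toPath
    refine hw r (w.support_bypass_subset_support ?_)
    have e' : p = w.bypass := congrArg Subtype.val e
    exact e' ▸ hr

theorem finite_colimitCocone (hG : Finite G.Vert) (hD : ∀ j, Finite (D.obj j).verts) :
    Finite (colimitCocone D).pt.verts := by
  refine Finite.of_surjective (α := Σ v : G.Vert, (D.obj (G.ofVert v)).verts)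
    (fun x => ((colimitCocone D).ι.app (G.ofVert x.1)).toFun x.2) fun p => ?_
  obtain ⟨j, a, rfl⟩ := (D ⋙ vertsFunctor).ιColimitType_jointly_surjective p
  obtain ⟨b, hb⟩ := ι_mem_bag j a
  exact ⟨⟨_, b⟩, hb⟩

end ReflGraph

theorem isChordal_lanConst (τ : StrDecomp.{u} FintypeCat.{u}) (hτ : τ.shape.IsFiniteTree) :
    IsChordal ((StrDecomp.lanConst completeGraphFunctor.{u}).obj τ) := by
  let D := τ.diagram ⋙ completeGraphFunctor.{u}
  have : Finite τ.shape.Vert := hτ.finite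
  have : Finite (ReflGraph.colimitCocone D).pt.verts :=
    ReflGraph.finite_colimitCocone hτ.finite fun j => (τ.diagram.obj j).property
  have h : IsCliqueTree _ (ReflGraph.colimitCocone D).pt _ :=
    ReflGraph.isCliqueTree_bag (D := D) hτ fun j x y hxy => hxy
  exact h.isChordal.of_iso
    ((ReflGraph.colimitCoconeIsColimit D).coconePointUniqueUpToIso (colimit.isColimit D))

/-! ### Joining two trees by an edge -/

namespace SimpleGraph

variable {V W : Type*} {G : SimpleGraph V} {H : SimpleGraph W}

/-- A cycle is connected, so it stays in one summand, and the subgraph induced there is a copy of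
`G` or `H`. -/
theorem IsAcyclic.sum (hG : G.IsAcyclic) (hH : H.IsAcyclic) : (G ⊕g H).IsAcyclic := by
  classical
  rintro (v | w) c hc
  · have hs : ∀ x ∈ c.support, x ∈ Set.range (Sum.inl : V → V ⊕ W) := by
      rintro (x | x) hx
      · exact ⟨x, rfl⟩
      · exact (not_reachable_sum_inl_inr _ _ ⟨c.takeUntil _ hx⟩).elim
    have key : ((G ⊕g H).induce (Set.range (Sum.inl : V → V ⊕ W))).IsAcyclic :=
      (Iso.isAcyclic_iff (⟨Equiv.ofInjective _ Sum.inl_injective, Iff.rfl⟩ :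
        G ≃g (G ⊕g H).induce (Set.range (Sum.inl : V → V ⊕ W)))).mp hG
    refine key (c.induce _ hs) ?_
    rw [← Walk.isCycle_map_iff_of_injective (f := (Embedding.induce _).toHom)
      Subtype.val_injective]
    simpa using hc
  · have hs : ∀ x ∈ c.support, x ∈ Set.range (Sum.inr : W → V ⊕ W) := by
      rintro (x | x) hx
      · exact (not_reachable_sum_inl_inr _ _ (Reachable.symm ⟨c.takeUntil _ hx⟩)).elim
      · exact ⟨x, rfl⟩
    have key : ((G ⊕g H).induce (Set.range (Sum.inr : W → V ⊕ W))).IsAcyclic :=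
      (Iso.isAcyclic_iff (⟨Equiv.ofInjective _ Sum.inr_injective, Iff.rfl⟩ :
        H ≃g (G ⊕g H).induce (Set.range (Sum.inr : W → V ⊕ W)))).mp hH
    refine key (c.induce _ hs) ?_
    rw [← Walk.isCycle_map_iff_of_injective (f := (Embedding.induce _).toHom)
      Subtype.val_injective]
    simpa using hc

theorem IsTree.sum_sup_edge (hG : G.IsTree) (hH : H.IsTree) (v : V) (w : W) :
    ((G ⊕g H) ⊔ edge (.inl v) (.inr w)).IsTree :=
  ⟨hG.connected.sum_sup_edge hH.connected, (hG.isAcyclic.sum hH.isAcyclic).sup_edge_of_not_reachable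
    (not_reachable_sum_inl_inr v w)⟩

end SimpleGraph

namespace ShapeGraph

/-- The graph with given edges, vertices, sources and targets. -/
abbrev mk {E V : Type u} (s t : E → V) : ShapeGraph.{u} :=
  parallelPair (X := E) (Y := V) (↾s) (↾t)

/-- The disjoint union of two graphs with an additional edge from `v` to `w`. -/
abbrev join (G H : ShapeGraph.{u}) (v : G.Vert) (w : H.Vert) : ShapeGraph.{u} :=
  mk (E := G.Edge ⊕ H.Edge ⊕ PUnit.{u + 1}) (V := G.Vert ⊕ H.Vert)
    (Sum.elim (fun e => .inl (G.src e)) (Sum.elim (fun e => .inr (H.src e)) fun _ => .inl v))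
    (Sum.elim (fun e => .inl (G.tgt e)) (Sum.elim (fun e => .inr (H.tgt e)) fun _ => .inr w))

theorem toSimpleGraph_join (G H : ShapeGraph.{u}) (v : G.Vert) (w : H.Vert) :
    (G.join H v w).toSimpleGraph =
      (G.toSimpleGraph ⊕g H.toSimpleGraph) ⊔ SimpleGraph.edge (.inl v) (.inr w) := by
  have key : ∀ x y : G.Vert ⊕ H.Vert, (∃ e, (G.join H v w).src e = x ∧ (G.join H v w).tgt e = y) ↔
      (∃ e, Sum.inl (G.src e) = x ∧ Sum.inl (G.tgt e) = y) ∨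
      (∃ e, Sum.inr (H.src e) = x ∧ Sum.inr (H.tgt e) = y) ∨ (Sum.inl v = x ∧ Sum.inr w = y) := by
    intro x y
    constructor
    · rintro ⟨e | e | e, h⟩
      · exact Or.inl ⟨e, h⟩
      · exact Or.inr (Or.inl ⟨e, h⟩)
      · exact Or.inr (Or.inr h)
    · rintro (⟨e, h⟩ | ⟨e, h⟩ | h)
      · exact ⟨.inl e, h⟩
      · exact ⟨.inr (.inl e), h⟩
      · exact ⟨.inr (.inr ⟨⟩), h⟩
  ext x y
  rw [SimpleGraph.fromRel_adj, key, key, SimpleGraph.sup_adj, SimpleGraph.edge_adj]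
  rcases x with x | x <;> rcases y with y | y <;> simp [SimpleGraph.sum, eq_comm, and_comm]

theorem IsFiniteTree.join {G H : ShapeGraph.{u}} (hG : G.IsFiniteTree) (hH : H.IsFiniteTree)
    (v : G.Vert) (w : H.Vert) : (G.join H v w).IsFiniteTree where
  finite := by
    have := hG.finite
    have := hH.finite
    exact inferInstanceAs (Finite (G.Vert ⊕ H.Vert))
  loopless := by
    rintro (e | e | e) h
    · exact hG.loopless e (Sum.inl_injective h)
    · exact hH.loopless e (Sum.inr_injective h)
    · exact Sum.inl_ne_inr h
  simple := by
    rintro (e | e | e) (e' | e' | e') h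
    case inl.inl => exact congrArg _ (hG.simple e e' (Sym2.map.injective Sum.inl_injective h))
    case inr.inl.inr.inl =>
      exact congrArg (fun x => Sum.inr (Sum.inl x))
        (hH.simple e e' (Sym2.map.injective Sum.inr_injective h))
    case inr.inr.inr.inr => rfl
    -- Edges of different kinds differ in the sides of their endpoints, so any matching identifies a
    -- left vertex with a right one.
    all_goals
      rcases Sym2.eq_iff.mp h with ⟨h₁, h₂⟩ | ⟨h₁, h₂⟩ <;>
      first
      | exact absurd h₁ Sum.inl_ne_inr
      | exact absurd h₁ Sum.inr_ne_inl
      | exact absurd h₂ Sum.inl_ne_inr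
      | exact absurd h₂ Sum.inr_ne_inl
  isTree := by
    have h := hG.isTree.sum_sup_edge hH.isTree v w
    rw [← toSimpleGraph_join] at h
    exact h

/-! ### Functors and cocones on the category of elements -/

variable {C : Type*} [Category* C]

section

variable {G : ShapeGraph.{u}} (objE : G.Edge → C) (objV : G.Vert → C)
  (l : ∀ e, objE e ⟶ objV (G.src e)) (r : ∀ e, objE e ⟶ objV (G.tgt e))

theorem eq_of_map_id {X : WalkingParallelPair} {x y : G.obj X}
    (h : G.map (WalkingParallelPairHom.id X : X ⟶ X) x = y) : x = y := by
  have h' : G.map (𝟙 X) x = x := ConcreteCategory.congr_hom (G.map_id X) x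
  exact h'.symm.trans h

/-- The action on objects of `functorMk`. -/
def objMk : ∀ X : WalkingParallelPair, G.obj X → C
  | .zero, e => objE e
  | .one, v => objV v

/-- The action on morphisms of `functorMk`. -/
def mapMk {X Y : WalkingParallelPair} (f : WalkingParallelPairHom X Y) (x : G.obj X) (y : G.obj Y)
    (h : G.map f x = y) : objMk objE objV X x ⟶ objMk objE objV Y y :=
  match X, Y, f, x, y, h with
  | _, _, .left, x, _, h => l x ≫ eqToHom (congrArg objV h)
  | _, _, .right, x, _, h => r x ≫ eqToHom (congrArg objV h)
  | X, _, .id _, _, _, h => eqToHom (congrArg (objMk objE objV X) (eq_of_map_id h))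

/-- A functor on the category of elements, given by its values on edges and vertices. -/
def functorMk : G.Elements ⥤ C where
  obj j := objMk objE objV j.1 j.2
  map {j k} f := mapMk objE objV l r f.1 j.2 k.2 f.2
  map_id j := rfl
  map_comp {i j k} f g := by
    -- No two non-identity arrows compose: only the identity leaves a vertex, and only the identity
    -- enters an edge.
    have key : ∀ {i k : G.Elements} (v : G.Vert) (f : i ⟶ G.ofVert v) (g : G.ofVert v ⟶ k),
        mapMk objE objV l r (f ≫ g).1 i.2 k.2 (f ≫ g).2 =
          mapMk objE objV l r f.1 i.2 v f.2 ≫ mapMk objE objV l r g.1 v k.2 g.2 := by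
      rintro i ⟨Z, z⟩ v f ⟨g, hg⟩
      change WalkingParallelPairHom .one Z at g
      cases g
      obtain rfl := eq_of_map_id hg
      refine Eq.trans ?_ (Category.comp_id _).symm
      congr 1
      exact WalkingParallelPairHom.comp_id f.1
    obtain ⟨_ | _, x⟩ := j
    · obtain ⟨Y, y⟩ := i
      obtain ⟨f, hf⟩ := f
      change WalkingParallelPairHom Y .zero at f
      cases f
      obtain rfl := eq_of_map_id hf
      refine Eq.trans ?_ (Category.id_comp _).symm
      congr 1
    · exact key x f g

theorem functorMk_map_toSrc (e : G.Edge) :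
    (functorMk objE objV l r).map (G.toSrc e) = l e :=
  Category.comp_id _

theorem functorMk_map_toTgt (e : G.Edge) :
    (functorMk objE objV l r).map (G.toTgt e) = r e :=
  Category.comp_id _

end

section

variable {G : ShapeGraph.{u}} {D : G.Elements ⥤ C}

/-- A cocone over a diagram on the category of elements, given by its legs at the vertices. -/
def coconeMk (X : C) (a : ∀ v, D.obj (G.ofVert v) ⟶ X)
    (h : ∀ e, D.map (G.toSrc e) ≫ a (G.src e) = D.map (G.toTgt e) ≫ a (G.tgt e)) : Cocone D where
  pt := X
  ι :=
    { app := fun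
        | ⟨.zero, e⟩ => D.map (G.toSrc e) ≫ a (G.src e)
        | ⟨.one, v⟩ => a v
      naturality := fun j k f => by
        refine Eq.trans ?_ (Category.comp_id _).symm
        induction f using hom_induction with
        | id j => rw [D.map_id, Category.id_comp]
        | src e => rfl
        | tgt e => exact (h e).symm }

theorem cocone_hom_ext {c : Cocone D} (hc : IsColimit c) {X : C} {f g : c.pt ⟶ X}
    (h : ∀ v, c.ι.app (G.ofVert v) ≫ f = c.ι.app (G.ofVert v) ≫ g) : f = g := by
  refine hc.hom_ext fun ⟨Y, x⟩ => ?_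
  cases Y with
  | one => exact h x
  | zero => rw [← c.w (G.toSrc x), Category.assoc, Category.assoc, h]

/-- A colimit cocone can be recognized by its legs at the vertices. -/
def isColimitMk {c : Cocone D} (desc : ∀ s : Cocone D, c.pt ⟶ s.pt)
    (fac : ∀ (s : Cocone D) v, c.ι.app (G.ofVert v) ≫ desc s = s.ι.app (G.ofVert v))
    (uniq : ∀ (s : Cocone D) (f g : c.pt ⟶ s.pt),
      (∀ v, c.ι.app (G.ofVert v) ≫ f = c.ι.app (G.ofVert v) ≫ g) → f = g) : IsColimit c where
  desc := desc
  fac s := fun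
    | ⟨.zero, e⟩ => by
      rw [← c.w (G.toSrc e), Category.assoc, fac, s.w (G.toSrc e)]
    | ⟨.one, v⟩ => fac s v
  uniq s m hm := uniq s _ _ fun v => (hm _).trans (fac s v).symm

end

end ShapeGraph

/-! ### The colimit of a join as a pushout -/

namespace StrDecomp

variable {K : Type*} [Category* K] {C : Type*} [Category* C]

section

variable (d₁ d₂ : StrDecomp.{u} K) {x : K} {v : d₁.shape.Vert} {w : d₂.shape.Vert}
  (a : x ⟶ d₁.diagram.obj (d₁.shape.ofVert v)) (b : x ⟶ d₂.diagram.obj (d₂.shape.ofVert w))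

/-- The values of `join` on edges. -/
abbrev joinEdge (x : K) : (d₁.shape.join d₂.shape v w).Edge → K :=
  Sum.elim (fun e => d₁.diagram.obj (d₁.shape.ofEdge e))
    (Sum.elim (fun e => d₂.diagram.obj (d₂.shape.ofEdge e)) fun _ => x)

/-- The values of `join` on vertices. -/
abbrev joinVert : (d₁.shape.join d₂.shape v w).Vert → K :=
  Sum.elim (fun t => d₁.diagram.obj (d₁.shape.ofVert t))
    fun t => d₂.diagram.obj (d₂.shape.ofVert t)

variable {d₁ d₂}

/-- The maps of `join` from edges to their sources. -/
abbrev joinSrc : ∀ e : (d₁.shape.join d₂.shape v w).Edge,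
    joinEdge d₁ d₂ x e ⟶ joinVert d₁ d₂ ((d₁.shape.join d₂.shape v w).src e)
  | .inl e => d₁.diagram.map (d₁.shape.toSrc e)
  | .inr (.inl e) => d₂.diagram.map (d₂.shape.toSrc e)
  | .inr (.inr _) => a

/-- The maps of `join` from edges to their targets. -/
abbrev joinTgt : ∀ e : (d₁.shape.join d₂.shape v w).Edge,
    joinEdge d₁ d₂ x e ⟶ joinVert d₁ d₂ ((d₁.shape.join d₂.shape v w).tgt e)
  | .inl e => d₁.diagram.map (d₁.shape.toTgt e)
  | .inr (.inl e) => d₂.diagram.map (d₂.shape.toTgt e)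
  | .inr (.inr _) => b

/-- Two decompositions, joined by an additional edge with value `x`. -/
def join : StrDecomp.{u} K where
  shape := d₁.shape.join d₂.shape v w
  diagram := ShapeGraph.functorMk (joinEdge d₁ d₂ x) (joinVert d₁ d₂) (joinSrc a) (joinTgt b)

variable {a b} {Ω : K ⥤ C}

/-- Cocones over two decompositions that agree on the additional edge give one over their join. -/
def joinCocone (c₁ : Cocone (d₁.diagram ⋙ Ω)) (c₂ : Cocone (d₂.diagram ⋙ Ω)) {H : C}
    (i : c₁.pt ⟶ H) (j : c₂.pt ⟶ H)
    (h : (Ω.map a ≫ c₁.ι.app (d₁.shape.ofVert v)) ≫ i =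
      (Ω.map b ≫ c₂.ι.app (d₂.shape.ofVert w)) ≫ j) :
    Cocone ((join a b).diagram ⋙ Ω) :=
  ShapeGraph.coconeMk H
    (fun
      | .inl t => c₁.ι.app (d₁.shape.ofVert t) ≫ i
      | .inr t => c₂.ι.app (d₂.shape.ofVert t) ≫ j)
    (fun e => by
      refine (congrArg (fun t => Ω.map t ≫ _)
        (ShapeGraph.functorMk_map_toSrc _ _ _ _ e)).trans (Eq.trans ?_
        (congrArg (fun t => Ω.map t ≫ _) (ShapeGraph.functorMk_map_toTgt _ _ _ _ e)).symm)
      rcases e with e | e | e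
      · have h₁ := c₁.w (d₁.shape.toSrc e)
        have h₂ := c₁.w (d₁.shape.toTgt e)
        exact (Category.assoc _ _ _).symm.trans
          ((congrArg (· ≫ i) (h₁.trans h₂.symm)).trans (Category.assoc _ _ _))
      · have h₁ := c₂.w (d₂.shape.toSrc e)
        have h₂ := c₂.w (d₂.shape.toTgt e)
        exact (Category.assoc _ _ _).symm.trans
          ((congrArg (· ≫ j) (h₁.trans h₂.symm)).trans (Category.assoc _ _ _))
      · exact (Category.assoc _ _ _).symm.trans (h.trans (Category.assoc _ _ _)))

theorem w_toSrc_toTgt {d : StrDecomp.{u} K} (s : Cocone (d.diagram ⋙ Ω)) (e : d.shape.Edge) :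
    Ω.map (d.diagram.map (d.shape.toSrc e)) ≫ s.ι.app (d.shape.ofVert (d.shape.src e)) =
      Ω.map (d.diagram.map (d.shape.toTgt e)) ≫ s.ι.app (d.shape.ofVert (d.shape.tgt e)) :=
  (s.w (d.shape.toSrc e)).trans (s.w (d.shape.toTgt e)).symm

theorem w_join (s : Cocone ((join a b).diagram ⋙ Ω))
    (e : (d₁.shape.join d₂.shape v w).Edge) :
    Ω.map (joinSrc a e) ≫ s.ι.app ((d₁.shape.join d₂.shape v w).ofVert
        ((d₁.shape.join d₂.shape v w).src e)) =
      Ω.map (joinTgt b e) ≫ s.ι.app ((d₁.shape.join d₂.shape v w).ofVert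
        ((d₁.shape.join d₂.shape v w).tgt e)) :=
  ((congrArg (fun t => Ω.map t ≫ s.ι.app _)
    (ShapeGraph.functorMk_map_toSrc _ _ _ _ e).symm).trans (w_toSrc_toTgt s e)).trans
    (congrArg (fun t => Ω.map t ≫ s.ι.app _) (ShapeGraph.functorMk_map_toTgt _ _ _ _ e))

/-- The restriction of a cocone over a join to the first decomposition. -/
def restrictLeft (s : Cocone ((join a b).diagram ⋙ Ω)) : Cocone (d₁.diagram ⋙ Ω) :=
  ShapeGraph.coconeMk s.pt (fun t => s.ι.app ((d₁.shape.join d₂.shape v w).ofVert (.inl t)))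
    fun e => w_join s (.inl e)

/-- The restriction of a cocone over a join to the second decomposition. -/
def restrictRight (s : Cocone ((join a b).diagram ⋙ Ω)) : Cocone (d₂.diagram ⋙ Ω) :=
  ShapeGraph.coconeMk s.pt (fun t => s.ι.app ((d₁.shape.join d₂.shape v w).ofVert (.inr t)))
    fun e => w_join s (.inr (.inl e))

/-- The colimit of a join is the pushout of the two colimits. -/
theorem nonempty_isColimit_joinCocone {c₁ : Cocone (d₁.diagram ⋙ Ω)}
    {c₂ : Cocone (d₂.diagram ⋙ Ω)} (hc₁ : IsColimit c₁) (hc₂ : IsColimit c₂) {H : C}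
    {i : c₁.pt ⟶ H} {j : c₂.pt ⟶ H}
    (h : IsPushout (Ω.map a ≫ c₁.ι.app (d₁.shape.ofVert v))
      (Ω.map b ≫ c₂.ι.app (d₂.shape.ofVert w)) i j) :
    Nonempty (IsColimit (joinCocone c₁ c₂ i j h.w)) := by
  -- The cocone condition at the new edge is exactly the compatibility that the pushout requires.
  have hw : ∀ s : Cocone ((join a b).diagram ⋙ Ω),
      (Ω.map a ≫ c₁.ι.app (d₁.shape.ofVert v)) ≫ hc₁.desc (restrictLeft s) =
        (Ω.map b ≫ c₂.ι.app (d₂.shape.ofVert w)) ≫ hc₂.desc (restrictRight s) := fun s => by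
    rw [Category.assoc, Category.assoc, hc₁.fac, hc₂.fac]
    exact w_join s (.inr (.inr ⟨⟩))
  refine ⟨ShapeGraph.isColimitMk (fun s => h.desc _ _ (hw s)) ?_ ?_⟩
  · rintro s (t | t)
    · exact ((Category.assoc _ i _).trans (congrArg (_ ≫ ·) (h.inl_desc _ _ (hw s)))).trans
        (hc₁.fac (restrictLeft s) _)
    · exact ((Category.assoc _ j _).trans (congrArg (_ ≫ ·) (h.inr_desc _ _ (hw s)))).trans
        (hc₂.fac (restrictRight s) _)
  · intro s f g hfg
    refine h.hom_ext (ShapeGraph.cocone_hom_ext hc₁ fun t => ?_)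
      (ShapeGraph.cocone_hom_ext hc₂ fun t => ?_)
    · exact (Category.assoc _ _ _).symm.trans ((hfg (.inl t)).trans (Category.assoc _ _ _))
    · exact (Category.assoc _ _ _).symm.trans ((hfg (.inr t)).trans (Category.assoc _ _ _))

end

end StrDecomp

/-! ### Cliques in pushouts of graphs -/

namespace ReflGraph

theorem injective_of_mono {G H : ReflGraph.{u}} (f : G ⟶ H) [Mono f] :
    Function.Injective f.toFun := fun x y h => by
  let P : ReflGraph.{u} := ⟨PUnit, ⊥⟩
  let k : G.verts → (P ⟶ G) := fun x => Hom.mk (fun _ => x) fun _ _ h => h.elim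
  have e : k x ≫ f = k y ≫ f := hom_ext fun _ => h
  exact congrArg (fun t : P ⟶ G => t.toFun ⟨⟩) ((cancel_mono f).mp e)

/-- The graph on a set in which all vertices are adjacent. -/
def codiscrete : Type u ⥤ ReflGraph.{u} where
  obj X := ⟨X, ⊤⟩
  map f := Hom.mk (fun x => f x) fun _ _ _ => or_iff_not_imp_left.mpr fun h => h

/-- Taking the vertices is left adjoint to taking the complete graph. -/
def vertsAdjunction : vertsFunctor.{u} ⊣ codiscrete :=
  Adjunction.mkOfHomEquiv
    { homEquiv := fun _ _ =>
        { toFun := fun f => Hom.mk (fun x => f x) fun _ _ _ => or_iff_not_imp_left.mpr fun h => h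
          invFun := fun f => ↾f.toFun
          left_inv := fun _ => rfl
          right_inv := fun _ => rfl }
      homEquiv_naturality_left_symm := fun _ _ => rfl
      homEquiv_naturality_right := fun _ _ => rfl }

/-- Pushouts of graphs thus have pushouts of sets as vertex sets, and the facts about the latter
apply. -/
instance : PreservesColimitsOfSize.{0, 0} vertsFunctor.{u} :=
  vertsAdjunction.leftAdjoint_preservesColimits

section

variable {G H₁ H₂ H : ReflGraph.{u}} {f : G ⟶ H₁} {g : G ⟶ H₂} {i : H₁ ⟶ H} {j : H₂ ⟶ H}

theorem exists_of_isPushout (h : IsPushout f g i j) (x : H.verts) :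
    (∃ a, i.toFun a = x) ∨ ∃ b, j.toFun b = x :=
  Types.eq_or_eq_of_isPushout (h.map vertsFunctor) x

theorem exists_of_toFun_eq (h : IsPushout f g i j) (hf : Function.Injective f.toFun)
    {a : H₁.verts} {b : H₂.verts} (e : i.toFun a = j.toFun b) :
    ∃ x, f.toFun x = a ∧ g.toFun x = b :=
  (Types.pushoutCocone_inl_eq_inr_iff_of_isColimit (h.map vertsFunctor).isColimit hf a b).mp e

theorem injective_of_isPushout (h : IsPushout f g i j) (hg : Function.Injective g.toFun) :
    Function.Injective i.toFun :=
  Types.pushoutCocone_inr_injective_of_isColimit (h.map vertsFunctor).flip.isColimit hg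

/-- The edges of a pushout come from one of the two graphs. -/
theorem exists_adj_of_isPushout (h : IsPushout f g i j) {x y : H.verts} (hxy : H.graph.Adj x y) :
    (∃ a b, H₁.graph.Adj a b ∧ i.toFun a = x ∧ i.toFun b = y) ∨
      ∃ a b, H₂.graph.Adj a b ∧ j.toFun a = x ∧ j.toFun b = y := by
  let Q : H.verts → H.verts → Prop := fun x y =>
    (∃ a b, H₁.graph.Adj a b ∧ i.toFun a = x ∧ i.toFun b = y) ∨
      ∃ a b, H₂.graph.Adj a b ∧ j.toFun a = x ∧ j.toFun b = y
  have hQ : ∀ {x y}, Q x y → Q y x := by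
    rintro x y (⟨a, b, hab, hx, hy⟩ | ⟨a, b, hab, hx, hy⟩)
    · exact Or.inl ⟨b, a, hab.symm, hy, hx⟩
    · exact Or.inr ⟨b, a, hab.symm, hy, hx⟩
  -- `H'` keeps only the edges of `H` that come from one of the two sides. Both legs factor through
  -- it, so the universal property makes the identity on vertices a morphism from `H` to `H'`.
  let H' : ReflGraph.{u} := ⟨H.verts,
    { Adj := fun x y => H.graph.Adj x y ∧ Q x y
      symm := ⟨fun _ _ h => ⟨h.1.symm, hQ h.2⟩⟩
      loopless := ⟨fun _ h => h.1.ne rfl⟩ }⟩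
  let i' : H₁ ⟶ H' := Hom.mk i.toFun fun a b hab =>
    (i.map_adj a b hab).imp_right fun h => ⟨h, Or.inl ⟨a, b, hab, rfl, rfl⟩⟩
  let j' : H₂ ⟶ H' := Hom.mk j.toFun fun a b hab =>
    (j.map_adj a b hab).imp_right fun h => ⟨h, Or.inr ⟨a, b, hab, rfl, rfl⟩⟩
  let k : H' ⟶ H := Hom.mk id fun _ _ h => Or.inr h.1
  have hw : f ≫ i' = g ≫ j' :=
    hom_ext fun x => congrArg (fun t : G ⟶ H => t.toFun x) h.w
  have hk : h.desc i' j' hw ≫ k = 𝟙 H :=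
    h.hom_ext
      (by rw [h.inl_desc_assoc, Category.comp_id]; rfl)
      (by rw [h.inr_desc_assoc, Category.comp_id]; rfl)
  have hk' : ∀ x, (h.desc i' j' hw).toFun x = x := fun x =>
    congrArg (fun t : H ⟶ H => t.toFun x) hk
  have := (h.desc i' j' hw).map_adj x y hxy
  rw [hk' x, hk' y] at this
  exact (this.resolve_left hxy.ne).2

/-- `S` is a set of pairwise adjacent vertices. -/
def IsClique (H : ReflGraph.{u}) (S : Set H.verts) : Prop :=
  ∀ ⦃x⦄, x ∈ S → ∀ ⦃y⦄, y ∈ S → x ≠ y → H.graph.Adj x y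

/-- An edge coming from `H₂` between two vertices of `H₁` has both ends in the overlap `G`; as `G`
is complete, they are already adjacent in `H₁`. -/
theorem IsClique.preimage (h : IsPushout f g i j) (hf : Function.Injective f.toFun)
    (hg : Function.Injective g.toFun) (hG : ∀ x y, x ≠ y → G.graph.Adj x y) {S : Set H.verts}
    (hS : H.IsClique S) : H₁.IsClique (i.toFun ⁻¹' S) := by
  intro a ha b hb hab
  have hi := injective_of_isPushout h hg
  rcases exists_adj_of_isPushout h (hS ha hb (hi.ne hab)) with
    ⟨a', b', h', ea, eb⟩ | ⟨a', b', h', ea, eb⟩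
  · rwa [hi ea, hi eb] at h'
  · obtain ⟨x, rfl, rfl⟩ := exists_of_toFun_eq h hf ea.symm
    obtain ⟨y, rfl, rfl⟩ := exists_of_toFun_eq h hf eb.symm
    exact (f.map_adj x y (hG x y fun e => hab (e ▸ rfl))).resolve_left hab

/-- A clique in a pushout lies in one of the two graphs. -/
theorem IsClique.subset_range_or (h : IsPushout f g i j) {S : Set H.verts} (hS : H.IsClique S) :
    S ⊆ Set.range i.toFun ∨ S ⊆ Set.range j.toFun := by
  by_contra! hn
  obtain ⟨h₁, h₂⟩ := hn
  -- A vertex missing from the left and one missing from the right would be adjacent, but the edge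
  -- between them comes from a single side, which then contains both.
  obtain ⟨x, hx, hxi⟩ := Set.not_subset.mp h₁
  obtain ⟨y, hy, hyj⟩ := Set.not_subset.mp h₂
  have hxy : x ≠ y := by
    rintro rfl
    exact (exists_of_isPushout h x).elim hxi hyj
  rcases exists_adj_of_isPushout h (hS hx hy hxy) with ⟨a, b, -, ea, eb⟩ | ⟨a, b, -, ea, eb⟩
  · exact hxi ⟨a, ea⟩
  · exact hyj ⟨b, eb⟩

theorem isClique_range (hG : ∀ x y, x ≠ y → G.graph.Adj x y) (f : G ⟶ H₁) :
    H₁.IsClique (Set.range f.toFun) := by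
  rintro _ ⟨x, rfl⟩ _ ⟨y, rfl⟩ hxy
  exact (f.map_adj x y (hG x y fun e => hxy (e ▸ rfl))).resolve_left hxy

end

end ReflGraph

/-! ### Decompositions of chordal graphs -/

/-- `c` exhibits its apex as the colimit of a tree-shaped decomposition into complete graphs, such
that every clique lies in the image of one of the complete graphs. -/
structure IsTreeColimit {τ : StrDecomp.{u} FintypeCat.{u}}
    (c : Cocone (τ.diagram ⋙ completeGraphFunctor)) : Prop where
  isFiniteTree : τ.shape.IsFiniteTree
  isColimit : Nonempty (IsColimit c)
  exists_subset_range : ∀ S, c.pt.IsClique S →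
    ∃ v, S ⊆ Set.range (c.ι.app (τ.shape.ofVert v)).toFun

theorem ShapeGraph.isFiniteTree_point : point.{u}.IsFiniteTree where
  finite := inferInstanceAs (Finite PUnit)
  loopless e := PEmpty.elim e
  simple e := PEmpty.elim e
  isTree :=
    have : Nonempty point.{u}.Vert := inferInstanceAs (Nonempty PUnit)
    have : Subsingleton point.{u}.Vert := inferInstanceAs (Subsingleton PUnit)
    SimpleGraph.IsTree.of_subsingleton

/-- The cocone over a decomposition with a single bag. -/
def constCocone {X : FintypeCat.{u}} {H : ReflGraph.{u}} (e : completeGraphFunctor.obj X ⟶ H) :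
    Cocone (((StrDecomp.const FintypeCat.{u}).obj X).diagram ⋙ completeGraphFunctor) where
  pt := H
  ι := { app := fun _ => e }

theorem isTreeColimit_constCocone {X : FintypeCat.{u}} {H : ReflGraph.{u}}
    (e : completeGraphFunctor.obj X ≅ H) : IsTreeColimit (constCocone e.hom) where
  isFiniteTree := ShapeGraph.isFiniteTree_point
  isColimit := ⟨ShapeGraph.isColimitMk (fun s => e.inv ≫ s.ι.app ShapeGraph.pointElement)
    (fun _ _ => e.hom_inv_id_assoc _)
    fun _ _ _ h => (cancel_epi e.hom).mp (h PUnit.unit)⟩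
  exists_subset_range _ _ := ⟨PUnit.unit, fun x _ =>
    ⟨e.inv.toFun x, congrArg (fun t : H ⟶ H => t.toFun x) e.inv_hom_id⟩⟩

/-- The image of a complete graph is a clique, hence lies in one bag, and any choice of preimages
there is a morphism of finite sets. -/
theorem IsTreeColimit.exists_lift {τ : StrDecomp.{u} FintypeCat.{u}}
    {c : Cocone (τ.diagram ⋙ completeGraphFunctor)} (hc : IsTreeColimit c) {X : FintypeCat.{u}}
    (f : completeGraphFunctor.obj X ⟶ c.pt) :
    ∃ (v : τ.shape.Vert) (a : X ⟶ τ.diagram.obj (τ.shape.ofVert v)),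
      completeGraphFunctor.map a ≫ c.ι.app (τ.shape.ofVert v) = f := by
  obtain ⟨v, hv⟩ := hc.exists_subset_range _ (ReflGraph.isClique_range (fun _ _ h => h) f)
  choose a ha using fun x => hv ⟨x, rfl⟩
  exact ⟨v, FintypeCat.homMk a, ReflGraph.hom_ext ha⟩

theorem IsChordal.exists_isTreeColimit {H : ReflGraph.{u}} (h : IsChordal H) :
    ∃ (τ : StrDecomp.{u} FintypeCat.{u}) (c : Cocone (τ.diagram ⋙ completeGraphFunctor)),
      IsTreeColimit c ∧ c.pt = H := by
  induction h with
  | complete n H e => exact ⟨_, constCocone e.inv, isTreeColimit_constCocone e.symm, rfl⟩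
  | glue n f g i j hf hg _ _ h ih₁ ih₂ =>
    -- The apex equals the given graph, rather than being isomorphic to it, so the span and the
    -- pushout square are used unchanged.
    obtain ⟨τ₁, c₁, hc₁, rfl⟩ := ih₁
    obtain ⟨τ₂, c₂, hc₂, rfl⟩ := ih₂
    have hf' := ReflGraph.injective_of_mono f
    have hg' := ReflGraph.injective_of_mono g
    obtain ⟨v, a, rfl⟩ := hc₁.exists_lift f
    obtain ⟨w, b, rfl⟩ := hc₂.exists_lift g
    obtain ⟨l₁⟩ := hc₁.isColimit
    obtain ⟨l₂⟩ := hc₂.isColimit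
    refine ⟨StrDecomp.join a b, StrDecomp.joinCocone c₁ c₂ i j h.w,
      ⟨hc₁.isFiniteTree.join hc₂.isFiniteTree v w,
        StrDecomp.nonempty_isColimit_joinCocone l₁ l₂ h, fun S hS => ?_⟩, rfl⟩
    rcases ReflGraph.IsClique.subset_range_or h hS with hS' | hS'
    · obtain ⟨t, ht⟩ := hc₁.exists_subset_range _ (hS.preimage h hf' hg' fun _ _ h => h)
      refine ⟨.inl t, fun x hx => ?_⟩
      obtain ⟨y, rfl⟩ := hS' hx
      obtain ⟨z, rfl⟩ := ht hx
      exact ⟨z, rfl⟩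
    · obtain ⟨t, ht⟩ := hc₂.exists_subset_range _ (hS.preimage h.flip hg' hf' fun _ _ h => h)
      refine ⟨.inr t, fun x hx => ?_⟩
      obtain ⟨y, rfl⟩ := hS' hx
      obtain ⟨z, rfl⟩ := ht hx
      exact ⟨z, rfl⟩

theorem IsChordal.exists_decomposition {H : ReflGraph.{u}} (h : IsChordal H) :
    ∃ τ : StrDecomp.{u} FintypeCat.{u}, τ.shape.IsFiniteTree ∧
      Nonempty ((StrDecomp.lanConst completeGraphFunctor.{u}).obj τ ≅ H) := by
  obtain ⟨τ, c, hc, rfl⟩ := h.exists_isTreeColimit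
  obtain ⟨l⟩ := hc.isColimit
  exact ⟨τ, hc.isFiniteTree, ⟨(colimit.isColimit _).coconePointUniqueUpToIso l⟩⟩

theorem proposition5p3 :
    -- the gluing functor is a left Kan extension of the complete graph functor along `const`
    (∃ α : completeGraphFunctor.{u} ⟶
        StrDecomp.const FintypeCat.{u} ⋙ StrDecomp.lanConst completeGraphFunctor.{u},
      StrDecomp.IsLanConst completeGraphFunctor.{u}
        (StrDecomp.lanConst completeGraphFunctor.{u}) α) ∧
    -- tree-shaped decompositions are sent to chordal graphs
    (∀ τ : StrDecomp.{u} FintypeCat.{u}, τ.shape.IsFiniteTree →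
      IsChordal ((StrDecomp.lanConst completeGraphFunctor.{u}).obj τ)) ∧
    -- every chordal graph arises in this way
    (∀ H : ReflGraph.{u}, IsChordal H →
      ∃ τ : StrDecomp.{u} FintypeCat.{u}, τ.shape.IsFiniteTree ∧
        Nonempty ((StrDecomp.lanConst completeGraphFunctor.{u}).obj τ ≅ H)) := by
  exact ⟨⟨_, StrDecomp.isLanConst_lanUnit _⟩, isChordal_lanConst,
    fun _ h => h.exists_decomposition⟩
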